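/- Let $G=(V,E)$ be a finite simple graph with $V=\{1,\dots,N\}$ and $E\neq\emptyset$. A pairwise model on $G$ consists of a finite non-empty alphabet $\mathcal X$, potentials $\phi_e:\mathcal X\times\mathcal X\to[0,\infty)$ and weights $\theta_e\ge 0$ for $e\in E$; for $\eta\in\mathbb R^{E}$ put $$\Phi(\eta)=\log\sum_{x\in\mathcal X^N}\exp\Big(\sum_{e\in E}\eta_e\,\phi_e(x_e)\Big),\qquad x_e=(x_s,x_t)\ \text{ for } e=\{s,t\},\ s<t .$$ Let $\mathcal T(G)$ be the set of spanning trees of $G$ (if $G$ is disconnected: of spanning forests consisting of a spanning tree of each connected component), and let $\mathcal P(\mathcal T(G))$ be the set of probability distributions $\rho=(\rho^T)_{T\in\mathcal T(G)}$ on it. For $\rho\in\mathcal P(\mathcal T(G))$ let $\rho_e=\sum_{T\ni e}\rho^T$, and let $$L_\rho(\theta)=\sum_{T}\rho^T\,\Phi\big((\mathbf 1(e\in T)\,\theta_e)_{e}\big),\qquad U_\rho(\theta)=\sum_{T}\rho^T\,\Phi\big((\mathbf 1(e\in T)\,\theta_e/\rho_e)_{e}\big),\qquad \widehat\Phi_\rho(\theta)=\sqrt{L_\rho(\theta)\,U_\rho(\theta)}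 .$$ Then $\min_{e\in E}\rho_e$ attains its maximum over $\rho\in\mathcal P(\mathcal T(G))$, and for every maximizer $\rho^\star$ the estimator $\mathrm{TRW}'$, which outputs $\widehat\Phi_{\rho^\star}(\theta)$, satisfies $$\alpha(G,\mathrm{TRW}'):=\sup_{\mathcal X,\phi,\theta}\max\Big(\frac{\Phi(\theta)}{\widehat\Phi_{\rho^\star}(\theta)},\ \frac{\widehat\Phi_{\rho^\star}(\theta)}{\Phi(\theta)}\Big)\ \le\ \frac1{\sqrt{\kappa(G)}},\qquad \kappa(G)=\min_{S\subseteq V,\ E(S)\ne\emptyset}\frac{|S|-1}{|E(S)|},$$ where the supremum is over all pairwise models on $G$, the quotients are taken in $[0,\infty]$ (with $c/0=\infty$ for $c>0$, and $0/0=0$, which arises only for models with $\Phi(\theta)=\widehat\Phi_{\rho^\star}(\theta)=0$), and $E(S)$ is the set of edges of $G$ with both endpoints in $S$. -/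

import Mathlib

universe u

noncomputable section

namespace PairwiseTRW

/-! ### Pairwise graphical models and the log-partition function -/

/-- The log-partition function `Φ(θ) = log ∑ₓ exp (∑ₑ θₑ φₑ(xₑ))`, the outer sum being over all
`x ∈ 𝒳ᴺ` and the inner one over the edges of `G`. For an edge `e = {s, t}` with `s < t`,
`xₑ` is the ordered pair `(x_s, x_t)`; the potentials need not be symmetric. -/
def logPartition {N : ℕ} (G : SimpleGraph (Fin N)) {X : Type u} [Fintype X]
    (φ : G.edgeSet → X → X → ℝ) (θ : G.edgeSet → ℝ) : ℝ :=
  open Classical in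
  Real.log (∑ x : Fin N → X,
    Real.exp (∑ e : G.edgeSet, θ e * φ e (x e.1.inf) (x e.1.sup)))

/-- A pairwise graphical model on `G`: a finite non-empty alphabet, and on every edge a
non-negative potential and a non-negative weight. -/
structure PairwiseModel {N : ℕ} (G : SimpleGraph (Fin N)) : Type (u + 1) where
  /-- the alphabet -/
  X : Type u
  [fintypeX : Fintype X]
  [nonemptyX : Nonempty X]
  /-- the edge potentials -/
  φ : G.edgeSet → X → X → ℝ
  φ_nonneg : ∀ e a b, 0 ≤ φ e a b
  /-- the edge weights -/
  θ : G.edgeSet → ℝ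
  θ_nonneg : ∀ e, 0 ≤ θ e

attribute [instance] PairwiseModel.fintypeX PairwiseModel.nonemptyX

/-- The log-partition function of a model. -/
def PairwiseModel.logZ {N : ℕ} {G : SimpleGraph (Fin N)} (P : PairwiseModel.{u} G) : ℝ :=
  logPartition G P.φ P.θ

/-- The approximation ratio on `G` of a method `est` that assigns an estimate of the log-partition
function to every model on `G`: the supremum over all models of `max (Φ / est) (est / Φ)`.
The quotients are taken in `[0, ∞]`, where `c / 0 = ∞` for `c > 0`. -/
def approxRatio {N : ℕ} (G : SimpleGraph (Fin N)) (est : PairwiseModel.{u} G → ℝ) : ENNReal :=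
  ⨆ P : PairwiseModel.{u} G,
    max (ENNReal.ofReal P.logZ / ENNReal.ofReal (est P))
      (ENNReal.ofReal (est P) / ENNReal.ofReal P.logZ)

/-! ### Spanning trees and distributions on them -/

/-- `T` is a spanning tree of `G`: a cycle-free subgraph on all the vertices that connects any two
vertices that `G` connects. For connected `G` this says exactly that `T` is a subgraph of `G` and
a tree (`isSpanningTree_iff_of_connected`); for disconnected `G`, the restriction of `T` to each
connected component of `G` is a spanning tree of that component. -/
def IsSpanningTree {N : ℕ} (G T : SimpleGraph (Fin N)) : Prop :=
  T ≤ G ∧ T.IsAcyclic ∧ ∀ u v, G.Reachable u v → T.Reachable u v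

theorem isSpanningTree_iff_of_connected {N : ℕ} {G : SimpleGraph (Fin N)} (hG : G.Connected)
    (T : SimpleGraph (Fin N)) : IsSpanningTree G T ↔ T ≤ G ∧ T.IsTree := by
  constructor
  · rintro ⟨h1, h2, h3⟩
    have := hG.nonempty
    exact ⟨h1, ⟨⟨fun u v => h3 u v (hG.preconnected u v)⟩, h2⟩⟩
  · rintro ⟨h1, h2⟩
    exact ⟨h1, h2.isAcyclic, fun u v _ => h2.connected.preconnected u v⟩

/-- The set `𝒯(G)` of all spanning trees of `G`. -/
abbrev SpanningTree {N : ℕ} (G : SimpleGraph (Fin N)) : Type :=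
  {T : SimpleGraph (Fin N) // IsSpanningTree G T}

instance {N : ℕ} (G : SimpleGraph (Fin N)) : Fintype (SpanningTree G) := Fintype.ofFinite _

/-- The set `𝒫(𝒯(G))` of all probability distributions on the spanning trees of `G`. -/
abbrev treeDistributions {N : ℕ} (G : SimpleGraph (Fin N)) : Set (SpanningTree G → ℝ) :=
  stdSimplex ℝ (SpanningTree G)

open Classical in
/-- The probability `ρₑ` that the edge `e` lies in a random spanning tree with law `ρ`. -/
def edgeProb {N : ℕ} (G : SimpleGraph (Fin N)) (ρ : SpanningTree G → ℝ) (e : G.edgeSet) : ℝ :=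
  ∑ T : SpanningTree G, ρ T * (if (e : Sym2 (Fin N)) ∈ T.1.edgeSet then 1 else 0)

/-- `min_{e ∈ E} ρₑ` (a minimum as soon as `G` has an edge). -/
def minEdgeProb {N : ℕ} (G : SimpleGraph (Fin N)) (ρ : SpanningTree G → ℝ) : ℝ :=
  ⨅ e : G.edgeSet, edgeProb G ρ e

/-- `ρ` is an optimal distribution `ρ*(G)`: it maximizes `min_{e ∈ E} ρₑ` over `𝒫(𝒯(G))`. -/
def IsOptimalDistribution {N : ℕ} (G : SimpleGraph (Fin N)) (ρ : SpanningTree G → ℝ) : Prop :=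
  ρ ∈ treeDistributions G ∧ IsMaxOn (minEdgeProb G) (treeDistributions G) ρ

/-! ### The estimator -/

open Classical in
/-- The projection `Π^T(θ) = (𝟙(e ∈ T) θₑ)ₑ`. -/
def proj {N : ℕ} (G : SimpleGraph (Fin N)) (T : SpanningTree G) (θ : G.edgeSet → ℝ) :
    G.edgeSet → ℝ :=
  fun e => if (e : Sym2 (Fin N)) ∈ T.1.edgeSet then θ e else 0

open Classical in
/-- The reweighted projection `Π^T_ρ(θ) = (𝟙(e ∈ T) θₑ / ρₑ)ₑ`. -/
def reweightedProj {N : ℕ} (G : SimpleGraph (Fin N)) (ρ : SpanningTree G → ℝ)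
    (T : SpanningTree G) (θ : G.edgeSet → ℝ) : G.edgeSet → ℝ :=
  fun e => if (e : Sym2 (Fin N)) ∈ T.1.edgeSet then θ e / edgeProb G ρ e else 0

/-- The lower estimate `L_ρ(θ) = ∑_T ρ^T Φ(Π^T(θ))`. -/
def lowerEstimate {N : ℕ} (G : SimpleGraph (Fin N)) (ρ : SpanningTree G → ℝ)
    (P : PairwiseModel.{u} G) : ℝ :=
  ∑ T : SpanningTree G, ρ T * logPartition G P.φ (proj G T P.θ)

/-- The upper estimate `U_ρ(θ) = ∑_T ρ^T Φ(Π^T_ρ(θ))`. -/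
def upperEstimate {N : ℕ} (G : SimpleGraph (Fin N)) (ρ : SpanningTree G → ℝ)
    (P : PairwiseModel.{u} G) : ℝ :=
  ∑ T : SpanningTree G, ρ T * logPartition G P.φ (reweightedProj G ρ T P.θ)

/-- The estimate `√(L_ρ(θ) U_ρ(θ))`; the method TRW′ uses it with an optimal `ρ`. -/
def trwEstimate {N : ℕ} (G : SimpleGraph (Fin N)) (ρ : SpanningTree G → ℝ)
    (P : PairwiseModel.{u} G) : ℝ :=
  √(lowerEstimate G ρ P * upperEstimate G ρ P)

/-! ### The graph parameter -/

open Classical in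
/-- `E(S)`: the edges of `G` with both endpoints in `S`. -/
def edgesWithin {N : ℕ} (G : SimpleGraph (Fin N)) (S : Finset (Fin N)) : Finset (Sym2 (Fin N)) :=
  S.sym2.filter (fun e => e ∈ G.edgeSet)

/-- `κ(G) = min_S (|S| - 1) / |E(S)|`, over the vertex subsets `S` for which the quotient makes
sense, i.e. `E(S) ≠ ∅` (such an `S` exists as soon as `G` has an edge). -/
def kappa {N : ℕ} (G : SimpleGraph (Fin N)) : ℝ :=
  ⨅ S : {S : Finset (Fin N) // (edgesWithin G S).Nonempty},
    ((S.1.card : ℝ) - 1) / ((edgesWithin G S.1).card : ℝ)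

end PairwiseTRW

end

open PairwiseTRW

/-!
Let `k = κ(G)`, `L` and `U` the lower and the upper estimate for an optimal `ρ`.

*Approximation.* Non-negativity of the potentials gives `L ≤ Φ` (monotonicity), convexity of
log-sum-exp gives `Φ ≤ U`, since `θ` is the `ρ`-average of its reweighted projections, and
`Φ(t η) ≤ t Φ(η)` for `t ≥ 1` gives `k U ≤ L` as soon as `k ≤ ρₑ` for all edges `e`
(`mul_upperEstimate_le_lowerEstimate`). The geometric mean of `L` and `U` is then within a factor
`1 / √k` of `Φ` (`sqrt_mul_approx`).

*The bound `k ≤ ρₑ`.* If no distribution satisfied it, a separating hyperplane would provide weights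
`w ≥ 0` on the edges for which every spanning tree has weight less than `k ∑ₑ wₑ`
(`exists_kappa_le_edgeProb`). This contradicts the greedy algorithm: a spanning forest of any
`H ≤ G` has at least `k |E(H)|` edges, as one sees component by component from the definition of
`κ` (`kappa_mul_card_edgeFinset_le`), and peeling off the smallest weight repeatedly turns this
cardinality bound into the weighted one (`exists_heavy_forest`).
-/

namespace PairwiseTRW

open Finset

/-! ### The log-sum-exp function -/

/-- The function `f ↦ log ∑ᵢ exp (fᵢ)` on real functions on a finite type. -/
noncomputable def logSumExp {ι : Type*} [Fintype ι] (f : ι → ℝ) : ℝ :=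
  Real.log (∑ i, Real.exp (f i))

section LogSumExp

variable {ι : Type*} [Fintype ι] [Nonempty ι]

theorem exp_logSumExp (f : ι → ℝ) : Real.exp (logSumExp f) = ∑ i, Real.exp (f i) :=
  Real.exp_log (sum_pos (fun _ _ => Real.exp_pos _) univ_nonempty)

theorem logSumExp_le_iff {f : ι → ℝ} {a : ℝ} :
    logSumExp f ≤ a ↔ ∑ i, Real.exp (f i - a) ≤ 1 := by
  rw [← Real.exp_le_exp, exp_logSumExp]
  simp_rw [Real.exp_sub]
  rw [← sum_div, div_le_one (Real.exp_pos a)]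

theorem sum_exp_sub_logSumExp_le (f : ι → ℝ) : ∑ i, Real.exp (f i - logSumExp f) ≤ 1 :=
  logSumExp_le_iff.1 le_rfl

theorem le_logSumExp (f : ι → ℝ) (i : ι) : f i ≤ logSumExp f := by
  rw [← Real.exp_le_exp, exp_logSumExp]
  exact single_le_sum (f := fun i => Real.exp (f i)) (fun _ _ => (Real.exp_pos _).le) (mem_univ i)

theorem logSumExp_mono {f g : ι → ℝ} (h : ∀ i, f i ≤ g i) : logSumExp f ≤ logSumExp g := by
  rw [← Real.exp_le_exp, exp_logSumExp, exp_logSumExp]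
  exact sum_le_sum fun i _ => Real.exp_le_exp.2 (h i)

/-- This is `∑ᵢ aᵢ ^ t ≤ (∑ᵢ aᵢ) ^ t` for `aᵢ = exp (fᵢ)`, in logarithmic form. -/
theorem logSumExp_mul_le {t : ℝ} (ht : 1 ≤ t) (f : ι → ℝ) :
    logSumExp (fun i => t * f i) ≤ t * logSumExp f := by
  refine logSumExp_le_iff.2 (le_trans (sum_le_sum fun i _ => ?_) (sum_exp_sub_logSumExp_le f))
  rw [Real.exp_le_exp]
  nlinarith [le_logSumExp f i]

/-- Jensen's inequality for the convex function `logSumExp`. -/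
theorem logSumExp_sum_le {κ : Type*} [Fintype κ] {w : κ → ℝ} (hw : ∀ k, 0 ≤ w k)
    (hw1 : ∑ k, w k = 1) (f : κ → ι → ℝ) :
    logSumExp (fun i => ∑ k, w k * f k i) ≤ ∑ k, w k * logSumExp (f k) := by
  rw [logSumExp_le_iff]
  calc ∑ i, Real.exp (∑ k, w k * f k i - ∑ k, w k * logSumExp (f k))
      ≤ ∑ i, ∑ k, w k * Real.exp (f k i - logSumExp (f k)) := by
        refine sum_le_sum fun i _ => ?_
        rw [← sum_sub_distrib]
        simp_rw [← mul_sub]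
        simpa only [smul_eq_mul] using convexOn_exp.map_sum_le (t := univ) (w := w)
          (p := fun k => f k i - logSumExp (f k)) (fun k _ => hw k) hw1 (by simp)
    _ = ∑ k, w k * ∑ i, Real.exp (f k i - logSumExp (f k)) := by
        rw [sum_comm]
        simp_rw [mul_sum]
    _ ≤ ∑ k, w k * 1 :=
        sum_le_sum fun k _ => mul_le_mul_of_nonneg_left (sum_exp_sub_logSumExp_le _) (hw k)
    _ = 1 := by simpa using hw1

end LogSumExp

/-! ### Bounds for the log-partition function -/

section LogPartition

variable {N : ℕ} {G : SimpleGraph (Fin N)} {X : Type u} [Fintype X]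

open Classical in
/-- The exponent `∑ₑ θₑ φₑ(xₑ)` in the log-partition function. -/
noncomputable def energy (φ : G.edgeSet → X → X → ℝ) (θ : G.edgeSet → ℝ) (x : Fin N → X) : ℝ :=
  ∑ e : G.edgeSet, θ e * φ e (x e.1.inf) (x e.1.sup)

theorem logPartition_eq_logSumExp (φ : G.edgeSet → X → X → ℝ) (θ : G.edgeSet → ℝ) :
    logPartition G φ θ = logSumExp (energy φ θ) := by
  unfold logPartition logSumExp energy
  congr!

variable [Nonempty X] {φ : G.edgeSet → X → X → ℝ}

theorem logPartition_mono (hφ : ∀ e a b, 0 ≤ φ e a b) {θ θ' : G.edgeSet → ℝ}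
    (h : ∀ e, θ e ≤ θ' e) : logPartition G φ θ ≤ logPartition G φ θ' := by
  simp only [logPartition_eq_logSumExp]
  exact logSumExp_mono fun x => sum_le_sum fun e _ => mul_le_mul_of_nonneg_right (h e) (hφ _ _ _)

theorem logPartition_nonneg (hφ : ∀ e a b, 0 ≤ φ e a b) {θ : G.edgeSet → ℝ}
    (h : ∀ e, 0 ≤ θ e) : 0 ≤ logPartition G φ θ := by
  rw [logPartition_eq_logSumExp]
  let x : Fin N → X := fun _ => Classical.arbitrary X
  have h0 : 0 ≤ energy φ θ x := sum_nonneg fun e _ => mul_nonneg (h e) (hφ _ _ _)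
  exact h0.trans (le_logSumExp _ x)

theorem logPartition_mul_le {t : ℝ} (ht : 1 ≤ t) (θ : G.edgeSet → ℝ) :
    logPartition G φ (fun e => t * θ e) ≤ t * logPartition G φ θ := by
  simp only [logPartition_eq_logSumExp]
  convert logSumExp_mul_le ht (energy φ θ) using 3
  simp only [energy, mul_sum, mul_assoc]

theorem logPartition_sum_le {K : Type*} [Fintype K] {w : K → ℝ} (hw : ∀ k, 0 ≤ w k)
    (hw1 : ∑ k, w k = 1) (θ : K → G.edgeSet → ℝ) :
    logPartition G φ (fun e => ∑ k, w k * θ k e) ≤ ∑ k, w k * logPartition G φ (θ k) := by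
  simp only [logPartition_eq_logSumExp]
  convert logSumExp_sum_le hw hw1 (fun k => energy φ (θ k)) using 3 with x
  simp only [energy, mul_sum, sum_mul, mul_assoc]
  exact sum_comm

end LogPartition

/-! ### The graph parameter and the rank of edge sets -/

section Rank

variable {N : ℕ} {G : SimpleGraph (Fin N)}

theorem mem_edgesWithin {S : Finset (Fin N)} {u v : Fin N} :
    s(u, v) ∈ edgesWithin G S ↔ u ∈ S ∧ v ∈ S ∧ G.Adj u v := by
  simp [edgesWithin, and_assoc]

theorem one_lt_card_of_edgesWithin_nonempty {S : Finset (Fin N)} (h : (edgesWithin G S).Nonempty) :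
    1 < #S := by
  obtain ⟨e, he⟩ := h
  induction e with | _ u v
  rw [mem_edgesWithin] at he
  exact one_lt_card.2 ⟨u, he.1, v, he.2.1, he.2.2.ne⟩

theorem kappa_pos (hE : G.edgeSet.Nonempty) : 0 < kappa G := by
  obtain ⟨e, he⟩ := hE
  have hS : (edgesWithin G univ).Nonempty := ⟨e, by simpa [edgesWithin] using he⟩
  have : Nonempty {S : Finset (Fin N) // (edgesWithin G S).Nonempty} := ⟨⟨_, hS⟩⟩
  obtain ⟨S, h⟩ := exists_eq_ciInf_of_finite
    (f := fun S : {S : Finset (Fin N) // (edgesWithin G S).Nonempty} =>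
      ((S.1.card : ℝ) - 1) / ((edgesWithin G S.1).card : ℝ))
  rw [kappa, ← h]
  have h1 : (1 : ℝ) < #S.1 := by exact_mod_cast one_lt_card_of_edgesWithin_nonempty S.2
  have h2 : (0 : ℝ) < #(edgesWithin G S.1) := by exact_mod_cast S.2.card_pos
  exact div_pos (by linarith) h2

theorem kappa_mul_card_edgesWithin_le {S : Finset (Fin N)} (hS : S.Nonempty) :
    kappa G * #(edgesWithin G S) ≤ #S - 1 := by
  rcases (edgesWithin G S).eq_empty_or_nonempty with h | h
  · have : (1 : ℝ) ≤ #S := by exact_mod_cast hS.card_pos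
    simp [h, this]
  · have h2 : (0 : ℝ) < #(edgesWithin G S) := by exact_mod_cast h.card_pos
    rw [← le_div_iff₀ h2]
    exact ciInf_le (Set.finite_range _).bddBelow
      (⟨S, h⟩ : {S : Finset (Fin N) // (edgesWithin G S).Nonempty})

open Classical in
/-- The vertex set of a connected component, as a finset. -/
noncomputable def componentVerts {T : SimpleGraph (Fin N)} (c : T.ConnectedComponent) :
    Finset (Fin N) :=
  univ.filter fun v => T.connectedComponentMk v = c

theorem mem_componentVerts {T : SimpleGraph (Fin N)} {c : T.ConnectedComponent} {v : Fin N} :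
    v ∈ componentVerts c ↔ T.connectedComponentMk v = c := by
  simp [componentVerts]

open Classical in
/-- The components of `T` partition the edges of any graph whose edges join vertices that `T`
connects. -/
theorem card_edgeFinset_eq_sum_edgesWithin {H T : SimpleGraph (Fin N)}
    (h : ∀ u v, H.Adj u v → T.Reachable u v) :
    #H.edgeFinset = ∑ c : T.ConnectedComponent, #(edgesWithin H (componentVerts c)) := by
  rw [card_eq_sum_card_fiberwise (f := fun e : Sym2 (Fin N) => T.connectedComponentMk e.inf)
    (t := univ) (fun _ _ => mem_coe.2 (mem_univ _))]
  refine sum_congr rfl fun c _ => congrArg card ?_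
  ext e
  induction e with | _ u v
  simp only [mem_filter, SimpleGraph.mem_edgeFinset, SimpleGraph.mem_edgeSet, Sym2.inf_mk,
    mem_edgesWithin, mem_componentVerts]
  constructor
  · rintro ⟨ha, hc⟩
    have huv := SimpleGraph.ConnectedComponent.eq.2 (h u v ha)
    rcases le_total u v with h' | h'
    · rw [inf_eq_left.2 h'] at hc
      exact ⟨hc, huv ▸ hc, ha⟩
    · rw [inf_eq_right.2 h'] at hc
      exact ⟨huv ▸ hc, hc, ha⟩
  · rintro ⟨hu, hv, ha⟩
    refine ⟨ha, ?_⟩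
    rcases le_total u v with h' | h'
    · rwa [inf_eq_left.2 h']
    · rwa [inf_eq_right.2 h']

theorem card_componentVerts_le {T : SimpleGraph (Fin N)} (c : T.ConnectedComponent) :
    #(componentVerts c) ≤ #(edgesWithin T (componentVerts c)) + 1 := by
  classical
  have h := c.connected_toSimpleGraph.card_vert_le_card_edgeSet_add_one
  have h1 : Nat.card c = #(componentVerts c) :=
    Nat.subtype_card _ fun v => mem_componentVerts
  have h2 : Nat.card c.toSimpleGraph.edgeSet ≤ #(edgesWithin T (componentVerts c)) := by
    rw [← Nat.card_eq_finsetCard]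
    have hmem : ∀ e ∈ c.toSimpleGraph.edgeSet,
        e.map Subtype.val ∈ edgesWithin T (componentVerts c) := by
      intro e he
      induction e with | _ u v
      exact mem_edgesWithin.2 ⟨mem_componentVerts.2 u.2, mem_componentVerts.2 v.2, he⟩
    refine Nat.card_le_card_of_injective
      (fun e => (⟨e.1.map Subtype.val, hmem e.1 e.2⟩ : edgesWithin T (componentVerts c)))
      fun e e' h => Subtype.ext (Sym2.map.injective Subtype.val_injective (congrArg Subtype.val h))
  omega

open Classical in
/-- A subgraph `T` that connects the endpoints of all edges of `H ≤ G` has at least `κ(G) |H|`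
edges: in every component of `T`, it has at least as many edges as a spanning tree. -/
theorem kappa_mul_card_edgeFinset_le (hE : G.edgeSet.Nonempty) {H T : SimpleGraph (Fin N)}
    (hH : H ≤ G) (h : ∀ u v, H.Adj u v → T.Reachable u v) :
    kappa G * #H.edgeFinset ≤ #T.edgeFinset := by
  rw [card_edgeFinset_eq_sum_edgesWithin h,
    card_edgeFinset_eq_sum_edgesWithin fun u v (ha : T.Adj u v) => ha.reachable]
  push_cast
  rw [mul_sum]
  refine sum_le_sum fun c _ => ?_
  have hc : (componentVerts c).Nonempty := by
    induction c using SimpleGraph.ConnectedComponent.ind with | _ v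
    exact ⟨v, mem_componentVerts.2 rfl⟩
  have h1 : #(edgesWithin H (componentVerts c)) ≤ #(edgesWithin G (componentVerts c)) :=
    card_le_card (monotone_filter_right _ fun e _ he => SimpleGraph.edgeSet_mono hH he)
  have h2 : (#(componentVerts c) : ℝ) ≤ #(edgesWithin T (componentVerts c)) + 1 := by
    exact_mod_cast card_componentVerts_le c
  have h3 := mul_le_mul_of_nonneg_left (Nat.cast_le (α := ℝ).2 h1) (kappa_pos hE).le
  linarith [kappa_mul_card_edgesWithin_le (G := G) hc]

end Rank

/-! ### Heavy spanning trees -/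

section Greedy

variable {N : ℕ} {G : SimpleGraph (Fin N)}

open Classical in
/-- For non-negative weights, some spanning forest of `H` carries at least the fraction `κ(G)` of the
total weight of `H`. -/
theorem exists_heavy_forest (hE : G.edgeSet.Nonempty) (H : SimpleGraph (Fin N)) :
    H ≤ G → ∀ w : Sym2 (Fin N) → ℝ, (∀ e ∈ H.edgeSet, 0 ≤ w e) →
      ∃ T ≤ H, T.IsAcyclic ∧ T.Reachable = H.Reachable ∧
        kappa G * ∑ e ∈ H.edgeFinset, w e ≤ ∑ e ∈ T.edgeFinset, w e := by
  induction H using WellFoundedLT.induction with | _ H ih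
  intro hH w hw
  rcases H.edgeFinset.eq_empty_or_nonempty with h0 | h0
  · obtain rfl : H = ⊥ := SimpleGraph.edgeFinset_eq_empty.1 h0
    refine ⟨⊥, le_rfl, SimpleGraph.isAcyclic_bot, rfl, ?_⟩
    rw [h0, sum_empty, mul_zero]
  -- Split `w` into its minimum `m` on the edges of `H` and the excess `w - m`, which is supported
  -- on a smaller graph. A heavy forest for the excess extends to a spanning forest of `H`, and
  -- every spanning forest of `H` carries the constant part well.
  obtain ⟨e₀, he₀, hmin⟩ := exists_min_image _ w h0
  set m := w e₀
  obtain ⟨H', hmem⟩ : ∃ H' : SimpleGraph (Fin N), ∀ e, e ∈ H'.edgeSet ↔ e ∈ H.edgeSet ∧ m < w e :=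
    ⟨H.deleteEdges {e | w e ≤ m}, fun e => by
      rw [SimpleGraph.edgeSet_deleteEdges, Set.mem_sdiff, Set.mem_ofPred_eq, not_le]⟩
  have hle : H' ≤ H := SimpleGraph.edgeSet_subset_edgeSet.1 fun e he => ((hmem e).1 he).1
  have hlt : H' < H := by
    refine lt_of_le_of_ne hle fun h => ?_
    have h1 := SimpleGraph.mem_edgeFinset.1 he₀
    rw [← h, hmem] at h1
    exact lt_irrefl m h1.2
  obtain ⟨T', hT', hacyc', -, hw'⟩ := ih _ hlt (hle.trans hH) (fun e => w e - m) fun e he =>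
    sub_nonneg.2 ((hmem e).1 he).2.le
  obtain ⟨T, hT'T, hTH, hacyc, hreach⟩ :=
    SimpleGraph.exists_isAcyclic_reachable_eq_le_of_le_of_isAcyclic (hT'.trans hle) hacyc'
  refine ⟨T, hTH, hacyc, hreach, ?_⟩
  have hrank := kappa_mul_card_edgeFinset_le hE hH (T := T) fun u v ha => by
    rw [hreach]; exact ha.reachable
  have hm : 0 ≤ m := hw _ (SimpleGraph.mem_edgeFinset.1 he₀)
  have hsplit (K : SimpleGraph (Fin N)) :
      ∑ e ∈ K.edgeFinset, w e = ∑ e ∈ K.edgeFinset, (w e - m) + m * #K.edgeFinset := by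
    rw [sum_sub_distrib, sum_const, nsmul_eq_mul]; ring
  have hsum : ∑ e ∈ H.edgeFinset, (w e - m)
      = ∑ e ∈ H'.edgeFinset, (w e - m) := by
    symm
    refine sum_subset (SimpleGraph.edgeFinset_mono hle) fun e he hne => ?_
    have h1 : w e ≤ m := by
      by_contra h
      exact hne (SimpleGraph.mem_edgeFinset.2
        ((hmem e).2 ⟨SimpleGraph.mem_edgeFinset.1 he, not_le.1 h⟩))
    linarith [hmin e he]
  have hmono : ∑ e ∈ T'.edgeFinset, (w e - m) ≤ ∑ e ∈ T.edgeFinset, (w e - m) :=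
    sum_le_sum_of_subset_of_nonneg (SimpleGraph.edgeFinset_mono hT'T) fun e he _ =>
      sub_nonneg.2 (hmin e (SimpleGraph.edgeFinset_mono hTH he))
  rw [hsplit H, hsplit T, hsum]
  nlinarith [mul_le_mul_of_nonneg_left hrank hm]

end Greedy

/-! ### Optimal distributions -/

section Optimal

variable {N : ℕ} {G : SimpleGraph (Fin N)}

theorem spanningTree_nonempty (G : SimpleGraph (Fin N)) : Nonempty (SpanningTree G) := by
  obtain ⟨T, hT, hacyc, hreach⟩ := SimpleGraph.exists_isAcyclic_reachable_eq_le (G := G)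
  exact ⟨⟨T, hT, hacyc, fun u v h => by rwa [hreach]⟩⟩

theorem treeDistributions_nonempty (G : SimpleGraph (Fin N)) : (treeDistributions G).Nonempty := by
  classical
  obtain ⟨T⟩ := spanningTree_nonempty G
  exact ⟨_, single_mem_stdSimplex ℝ T⟩

theorem edgeProb_le_one {ρ : SpanningTree G → ℝ} (hρ : ρ ∈ treeDistributions G) (e : G.edgeSet) :
    edgeProb G ρ e ≤ 1 := by
  rw [← hρ.2]
  refine sum_le_sum fun T _ => ?_
  split_ifs <;> simp [hρ.1 T]

theorem continuous_edgeProb (e : G.edgeSet) : Continuous fun ρ => edgeProb G ρ e := by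
  unfold edgeProb
  fun_prop

theorem exists_isOptimalDistribution (hE : G.edgeSet.Nonempty) :
    ∃ ρ : SpanningTree G → ℝ, IsOptimalDistribution G ρ := by
  classical
  have : Nonempty G.edgeSet := hE.to_subtype
  have hcont : Continuous (minEdgeProb G) := by
    have : minEdgeProb G = fun ρ => univ.inf' univ_nonempty fun e => edgeProb G ρ e := by
      ext ρ
      exact (inf'_univ_eq_ciInf _).symm
    rw [this]
    exact Continuous.finset_inf'_apply _ fun e _ => continuous_edgeProb e
  exact (isCompact_stdSimplex ℝ _).exists_isMaxOn (treeDistributions_nonempty G)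
    hcont.continuousOn

/-- The edge probabilities of some distribution lie in the orthant `{y | ∀ e, κ(G) ≤ yₑ}`; otherwise a
separating hyperplane would be a weight for which every spanning tree is too light. -/
theorem exists_kappa_le_edgeProb (hE : G.edgeSet.Nonempty) :
    ∃ ρ ∈ treeDistributions G, ∀ e, kappa G ≤ edgeProb G ρ e := by
  classical
  by_contra! hcon
  let p : (SpanningTree G → ℝ) →ₗ[ℝ] (G.edgeSet → ℝ) :=
    { toFun := fun ρ e => edgeProb G ρ e
      map_add' := fun ρ σ => by ext e; simp only [edgeProb, Pi.add_apply, add_mul, sum_add_distrib]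
      map_smul' := fun a ρ => by ext e; simp [edgeProb, mul_sum] }
  have hp : Continuous p := continuous_pi continuous_edgeProb
  obtain ⟨f, u, v, hfu, huv, hfv⟩ := geometric_hahn_banach_compact_closed
    (s := p '' treeDistributions G) (t := Set.Ici fun _ => kappa G)
    ((convex_stdSimplex ℝ _).linear_image p) ((isCompact_stdSimplex ℝ _).image hp)
    (convex_Ici _) isClosed_Ici (by
      rw [Set.disjoint_left]
      rintro _ ⟨ρ, hρ, rfl⟩ h
      obtain ⟨e, he⟩ := hcon ρ hρ
      exact absurd (h e) (not_le.2 he))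
  have hf (y : G.edgeSet → ℝ) : f y = ∑ e, f (Pi.single e 1) * y e := by
    conv_lhs => rw [pi_eq_sum_univ' y]
    simp [map_sum, mul_comm]
  have hw (e : G.edgeSet) : 0 ≤ f (Pi.single e 1) := by
    by_contra! h
    have hκ := hfv (fun _ => kappa G) Set.self_mem_Ici
    -- the point of the orthant on the ray in direction `e` at which `f` takes the value `v`
    have hv := hfv ((fun _ => kappa G) + ((v - f fun _ => kappa G) / f (Pi.single e 1)) •
      Pi.single e 1) (by
        refine Set.mem_Ici.2 <| le_add_of_nonneg_right (smul_nonneg (div_nonneg_of_nonpos ?_ h.le) ?_)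
        · linarith
        · exact Pi.single_nonneg.2 zero_le_one)
    rw [map_add, map_smul, smul_eq_mul, div_mul_cancel₀ _ h.ne] at hv
    linarith
  let w : Sym2 (Fin N) → ℝ := fun e => if he : e ∈ G.edgeSet then f (Pi.single ⟨e, he⟩ 1) else 0
  have hwe (e : G.edgeSet) : w e = f (Pi.single e 1) := by simp [w]
  obtain ⟨T, hTG, hacyc, hreach, hT⟩ := exists_heavy_forest hE G le_rfl w fun e he => by
    simpa [w, he] using hw ⟨e, he⟩
  have hsum (K : SimpleGraph (Fin N)) (hK : K ≤ G) : ∑ e ∈ K.edgeFinset, w e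
      = ∑ e : G.edgeSet, w e * if (e : Sym2 (Fin N)) ∈ K.edgeSet then 1 else 0 := by
    simp only [mul_ite, mul_one, mul_zero]
    rw [← sum_filter]
    refine (sum_bij (fun e _ => e.1) (by simp) (fun _ _ _ _ => Subtype.ext)
      (fun e he => ?_) fun _ _ => rfl).symm
    have he' := SimpleGraph.mem_edgeFinset.1 he
    exact ⟨⟨e, SimpleGraph.edgeSet_mono hK he'⟩, by simpa using he', rfl⟩
  let S : SpanningTree G := ⟨T, hTG, hacyc, fun u v h => by rwa [hreach]⟩
  have h1 := hfu _ ⟨_, single_mem_stdSimplex ℝ S, rfl⟩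
  have h2 := hfv (fun _ => kappa G) Set.self_mem_Ici
  have h3 : f (p (Pi.single S 1)) = ∑ e ∈ T.edgeFinset, w e := by
    rw [hf, hsum T hTG]
    refine sum_congr rfl fun e _ => ?_
    rw [hwe]
    congr 1
    change ∑ T', Pi.single (M := fun _ => ℝ) S 1 T' * _ = _
    rw [sum_eq_single S (fun T' _ h => by rw [Pi.single_eq_of_ne h, zero_mul]) (by simp),
      Pi.single_eq_same, one_mul]
  have h4 : f (fun _ => kappa G) = kappa G * ∑ e ∈ G.edgeFinset, w e := by
    rw [hf, hsum G le_rfl, mul_sum]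
    refine sum_congr rfl fun e _ => ?_
    rw [hwe, if_pos e.2]
    ring
  linarith

theorem IsOptimalDistribution.kappa_le_edgeProb (hE : G.edgeSet.Nonempty)
    {ρ : SpanningTree G → ℝ} (hρ : IsOptimalDistribution G ρ) (e : G.edgeSet) :
    kappa G ≤ edgeProb G ρ e := by
  have : Nonempty G.edgeSet := ⟨e⟩
  obtain ⟨σ, hσ, h⟩ := exists_kappa_le_edgeProb hE
  calc kappa G ≤ minEdgeProb G σ := le_ciInf h
    _ ≤ minEdgeProb G ρ := hρ.2 hσ
    _ ≤ edgeProb G ρ e := ciInf_le (Set.finite_range _).bddBelow e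

end Optimal

/-! ### The estimates -/

section Estimates

variable {N : ℕ} {G : SimpleGraph (Fin N)} {ρ : SpanningTree G → ℝ}

theorem proj_nonneg (T : SpanningTree G) {θ : G.edgeSet → ℝ} (hθ : ∀ e, 0 ≤ θ e) (e : G.edgeSet) :
    0 ≤ proj G T θ e := by
  unfold proj
  split_ifs <;> simp [hθ e]

theorem lowerEstimate_nonneg (hρ : ρ ∈ treeDistributions G) (P : PairwiseModel.{u} G) :
    0 ≤ lowerEstimate G ρ P :=
  sum_nonneg fun T _ => mul_nonneg (hρ.1 T)
    (logPartition_nonneg P.φ_nonneg (proj_nonneg T P.θ_nonneg))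

theorem lowerEstimate_le_logZ (hρ : ρ ∈ treeDistributions G) (P : PairwiseModel.{u} G) :
    lowerEstimate G ρ P ≤ P.logZ := by
  calc lowerEstimate G ρ P ≤ ∑ T, ρ T * P.logZ := by
        refine sum_le_sum fun T _ => mul_le_mul_of_nonneg_left ?_ (hρ.1 T)
        refine logPartition_mono P.φ_nonneg fun e => ?_
        unfold proj
        split_ifs <;> simp [P.θ_nonneg e]
    _ = P.logZ := by rw [← sum_mul, hρ.2, one_mul]

/-- Reweighting makes `θ` the `ρ`-average of its projections, so this is Jensen's inequality. -/
theorem logZ_le_upperEstimate (hρ : ρ ∈ treeDistributions G) (hpos : ∀ e, 0 < edgeProb G ρ e)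
    (P : PairwiseModel.{u} G) : P.logZ ≤ upperEstimate G ρ P := by
  classical
  have h : P.θ = fun e => ∑ T, ρ T * reweightedProj G ρ T P.θ e := by
    ext e
    have h1 : ∑ T, ρ T * reweightedProj G ρ T P.θ e = edgeProb G ρ e * (P.θ e / edgeProb G ρ e) := by
      generalize hq : P.θ e / edgeProb G ρ e = q
      rw [edgeProb, sum_mul]
      refine sum_congr rfl fun T _ => ?_
      unfold reweightedProj
      split_ifs <;> simp [hq]
    rw [h1, mul_div_cancel₀ _ (hpos e).ne']
  calc P.logZ = logPartition G P.φ (fun e => ∑ T, ρ T * reweightedProj G ρ T P.θ e) := by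
        rw [← h]; rfl
    _ ≤ upperEstimate G ρ P := logPartition_sum_le hρ.1 hρ.2 _

theorem mul_upperEstimate_le_lowerEstimate (hρ : ρ ∈ treeDistributions G) {k : ℝ} (hk : 0 < k)
    (hk1 : k ≤ 1) (hle : ∀ e, k ≤ edgeProb G ρ e) (P : PairwiseModel.{u} G) :
    k * upperEstimate G ρ P ≤ lowerEstimate G ρ P := by
  unfold upperEstimate lowerEstimate
  rw [mul_sum]
  refine sum_le_sum fun T _ => ?_
  rw [mul_left_comm]
  refine mul_le_mul_of_nonneg_left ?_ (hρ.1 T)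
  have h1 : logPartition G P.φ (reweightedProj G ρ T P.θ)
      ≤ logPartition G P.φ (fun e => 1 / k * proj G T P.θ e) := by
    refine logPartition_mono P.φ_nonneg fun e => ?_
    unfold reweightedProj proj
    split_ifs
    · rw [one_div, inv_mul_eq_div]
      exact div_le_div_of_nonneg_left (P.θ_nonneg e) hk (hle e)
    · simp
  have h2 := h1.trans (logPartition_mul_le (one_le_one_div hk hk1) _)
  rwa [one_div, inv_mul_eq_div, le_div_iff₀' hk] at h2

/-- The geometric mean of two bounds `a ≤ z ≤ b` with `k b ≤ a` is within the factor `1 / √k`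
of `z`. -/
theorem sqrt_mul_approx {a b z k : ℝ} (ha : 0 ≤ a) (haz : a ≤ z) (hzb : z ≤ b) (hk : 0 < k)
    (hba : k * b ≤ a) : z ≤ 1 / √k * √(a * b) ∧ √(a * b) ≤ 1 / √k * z := by
  have hz := ha.trans haz
  have hs := Real.sqrt_pos.2 hk
  rw [one_div, inv_mul_eq_div, inv_mul_eq_div, le_div_iff₀ hs, le_div_iff₀ hs]
  constructor
  · refine Real.le_sqrt_of_sq_le ?_
    rw [mul_pow, Real.sq_sqrt hk.le]
    nlinarith [mul_le_mul hzb hzb hz (hz.trans hzb),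
      mul_le_mul_of_nonneg_right hba (hz.trans hzb)]
  · rw [← Real.sqrt_mul (mul_nonneg ha (hz.trans hzb))]
    refine Real.sqrt_le_iff.2 ⟨hz, ?_⟩
    nlinarith [mul_le_mul_of_nonneg_left hba ha, mul_le_mul haz haz ha hz]

end Estimates

end PairwiseTRW

/-- For every graph `G` with at least one edge, optimal spanning-tree distributions exist, and for
each of them the approximation ratio of TRW′ is at most `1 / √κ(G)`. -/
theorem theorem1 {N : ℕ} (G : SimpleGraph (Fin N)) (hE : G.edgeSet.Nonempty) :
    (∃ ρ : SpanningTree G → ℝ, IsOptimalDistribution G ρ) ∧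
      ∀ ρ : SpanningTree G → ℝ, IsOptimalDistribution G ρ →
        approxRatio.{u} G (trwEstimate.{u} G ρ) ≤ ENNReal.ofReal (1 / √(kappa G)) := by
  refine ⟨exists_isOptimalDistribution hE, fun ρ hρ => iSup_le fun P => ?_⟩
  have hle := hρ.kappa_le_edgeProb hE
  have hκ := kappa_pos hE
  have hκ1 : kappa G ≤ 1 := by
    obtain ⟨e, he⟩ := hE
    exact (hle ⟨e, he⟩).trans (edgeProb_le_one hρ.1 _)
  obtain ⟨h1, h2⟩ := sqrt_mul_approx (lowerEstimate_nonneg hρ.1 P) (lowerEstimate_le_logZ hρ.1 P)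
    (logZ_le_upperEstimate hρ.1 (fun e => hκ.trans_le (hle e)) P) hκ
    (mul_upperEstimate_le_lowerEstimate hρ.1 hκ hκ1 hle P)
  have hc : 0 ≤ 1 / √(kappa G) := by positivity
  -- in this form the bound also covers the quotient `0 / 0 = 0`
  refine max_le (ENNReal.div_le_of_le_mul ?_) (ENNReal.div_le_of_le_mul ?_) <;>
    rw [← ENNReal.ofReal_mul hc]
  · exact ENNReal.ofReal_le_ofReal h1
  · exact ENNReal.ofReal_le_ofReal h2
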